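/- Let $\kappa\neq 0$ and let $\mathbb{M}^2(\kappa)$ be the simply connected complete surface of constant curvature $\kappa$ (a sphere if $\kappa>0$, a hyperbolic plane if $\kappa<0$). In $\mathbb{M}^2(\kappa)\times\mathbb{R}$ let $\xi=\partial_t$ be the unit vertical field. For a smooth immersed surface $\Sigma$ with unit normal $N$, let $A X=-\overline\nabla_X N$ be the shape operator, $H=\tfrac12\operatorname{tr}A$ the mean curvature, $\nu=\langle N,\xi\rangle$ the angle function and $\mathbf T=\xi-\nu N$. If $H$ is constant, the Abresch--Rosenberg shape operator of $\Sigma$ is $$S_{AR}X=2H\,AX-\kappa\langle X,\mathbf T\rangle\mathbf T+\frac{\kappa}{2}|\mathbf T|^2X-2H^2X ,$$ and a smooth regular curve $\gamma:(-\varepsilon,\varepsilon)\to\Sigma$ is called an AR-line of curvature of $\Sigma$ if $S_{AR}(\gamma'(t))=\lambda(t)\gamma'(t)$ for a smooth function $\lambda:(-\varepsilon,\varepsilon)\to\mathbb{R}$. A curve is horizontal if it lies in a slice $\mathbb{M}^2(\kappa)\times\{t_0\}$, and it is vertical in $\Sigma$ if it is, up to parametrization, an integral curve of $\mathbf T$.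 Let $\Sigma_1,\Sigma_2$ be immersed surfaces in $\mathbb{M}^2(\kappa)\times\mathbb{R}$ with unit normals $N_1,N_2$, constant mean curvatures $H_1,H_2$ and angle functions $\nu_1,\nu_2$, and assume that it is not the case that $H_1=0$ and $H_2\neq0$. Let $\Gamma\subset\Sigma_1\cap\Sigma_2$ be a regular curve parametrized by $\gamma:(-\varepsilon,\varepsilon)\to\Gamma$. Suppose that $\Sigma_1$ and $\Sigma_2$ intersect transversally along $\Gamma$ at a constant angle (that is, $\langle N_1,N_2\rangle$ is constant along $\Gamma$) and that $\Gamma$ is an AR-line of curvature of $\Sigma_1$. Assume that one of the following holds: 1. $\Gamma$ is horizontal; 2. $\Gamma$ is vertical in both $\Sigma_1$ and $\Sigma_2$; 3. $H_1=H_2\neq0$ and $\nu_1=-\nu_2$ along $\Gamma$. Then $\Gamma$ is an AR-line of curvature of $\Sigma_2$. -/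

import Mathlib

open Set
open scoped Manifold ContDiff

noncomputable section

/-! ### The ambient space `M²(κ) × ℝ`, for `κ ≠ 0`

`M²(κ)` is the round sphere `⟨x, x⟩ = 1/κ` of Euclidean `ℝ³` if `0 < κ`, and the upper sheet of the
hyperboloid `⟨x, x⟩ = 1/κ` of Lorentzian `ℝ³` if `κ < 0`, with the induced metric. -/

/-- The linear space `ℝ³ × ℝ` that contains `M²(κ) × ℝ`. -/
abbrev Amb : Type := (Fin 3 → ℝ) × ℝ

/-- The Euclidean (`0 < κ`) or Lorentzian (`κ < 0`) scalar product of `ℝ³`. -/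
def baseForm (κ : ℝ) (x y : Fin 3 → ℝ) : ℝ :=
  (if 0 < κ then x 0 * y 0 else -(x 0 * y 0)) + x 1 * y 1 + x 2 * y 2

/-- The simply connected complete surface `M²(κ)` of constant curvature `κ ≠ 0`. -/
def spaceForm (κ : ℝ) : Set (Fin 3 → ℝ) :=
  {x | baseForm κ x x = 1 / κ ∧ (κ < 0 → 0 < x 0)}

/-- The product `M²(κ) × ℝ`. -/
def prodSpace (κ : ℝ) : Set Amb := {p | p.1 ∈ spaceForm κ}

/-- The scalar product of `ℝ³ × ℝ` that induces the product metric of `M²(κ) × ℝ`. -/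
def ambForm (κ : ℝ) (v w : Amb) : ℝ := baseForm κ v.1 w.1 + v.2 * w.2

/-- The tangent space of `M²(κ) × ℝ` at `p`. -/
def tangentPlane (κ : ℝ) (p : Amb) : Submodule ℝ Amb where
  carrier := {v | baseForm κ p.1 v.1 = 0}
  zero_mem' := by simp [baseForm]
  add_mem' := by
    intro a b ha hb
    simp only [mem_ofPred_eq, baseForm, Prod.fst_add, Pi.add_apply] at *
    split_ifs at * <;> linarith
  smul_mem' := by
    intro c a ha
    simp only [mem_ofPred_eq, baseForm, Prod.smul_fst, Pi.smul_apply, smul_eq_mul] at *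
    split_ifs at * <;> linear_combination c * ha

/-- The orthogonal projection of `ℝ³ × ℝ` onto the tangent space of `M²(κ) × ℝ` at `p`
(the normal line at `p` is spanned by `(p.1, 0)`, of square `1/κ`). -/
def tangProj (κ : ℝ) (p v : Amb) : Amb := (v.1 - (κ * baseForm κ v.1 p.1) • p.1, v.2)

theorem tangProj_mem {κ : ℝ} (hκ : κ ≠ 0) {p : Amb} (hp : p ∈ prodSpace κ) (v : Amb) :
    tangProj κ p v ∈ tangentPlane κ p := by
  have h : baseForm κ p.1 p.1 = 1 / κ := hp.1
  have e : baseForm κ p.1 (v.1 - (κ * baseForm κ v.1 p.1) • p.1)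
      = baseForm κ v.1 p.1 - κ * baseForm κ v.1 p.1 * baseForm κ p.1 p.1 := by
    simp only [baseForm, Pi.sub_apply, Pi.smul_apply, smul_eq_mul]
    split_ifs <;> ring
  change baseForm κ p.1 (v.1 - (κ * baseForm κ v.1 p.1) • p.1) = 0
  rw [e, h]
  field_simp
  ring

/-- The unit vertical vector field of `M²(κ) × ℝ`. -/
def vertField : Amb := (0, 1)

/-! ### Immersed oriented surfaces -/

section Surfaces

variable {S : Type*} [TopologicalSpace S] [ChartedSpace (EuclideanSpace ℝ (Fin 2)) S]

/-- The derivative at `x` of a map from the surface `S` to `ℝ³ × ℝ`. -/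
def ambDeriv (g : S → Amb) (x : S) : TangentSpace (𝓡 2) x →L[ℝ] Amb :=
  mfderiv (𝓡 2) 𝓘(ℝ, Amb) g x

variable (S) in
/-- A smooth immersion of the surface `S` in `M²(κ) × ℝ`, oriented by a smooth unit normal
vector field. -/
structure ImmersedSurface (κ : ℝ) where
  /-- the immersion -/
  imm : S → Amb
  /-- the unit normal vector field -/
  normal : S → Amb
  imm_smooth : ContMDiff (𝓡 2) 𝓘(ℝ, Amb) ∞ imm
  imm_mem : ∀ x, imm x ∈ prodSpace κ
  imm_injective : ∀ x, Function.Injective (ambDeriv imm x)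
  normal_smooth : ContMDiff (𝓡 2) 𝓘(ℝ, Amb) ∞ normal
  normal_mem : ∀ x, normal x ∈ tangentPlane κ (imm x)
  normal_unit : ∀ x, ambForm κ (normal x) (normal x) = 1
  normal_orthogonal : ∀ x X, ambForm κ (normal x) (ambDeriv imm x X) = 0

namespace ImmersedSurface

variable {κ : ℝ} (F : ImmersedSurface S κ)

/-- The first fundamental form. -/
def firstForm (x : S) (X Y : TangentSpace (𝓡 2) x) : ℝ :=
  ambForm κ (ambDeriv F.imm x X) (ambDeriv F.imm x Y)

/-- The shape operator `A X = -∇̄_X N`. Tangent vectors of the surface in the values are written as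
vectors of the ambient space; the Levi-Civita connection `∇̄` of `M²(κ) × ℝ` is the tangential part
of the flat connection of `ℝ³ × ℝ`. -/
def shape (x : S) (X : TangentSpace (𝓡 2) x) : Amb :=
  -tangProj κ (F.imm x) (ambDeriv F.normal x X)

/-- The second fundamental form. -/
def secondForm (x : S) (X Y : TangentSpace (𝓡 2) x) : ℝ :=
  ambForm κ (F.shape x X) (ambDeriv F.imm x Y)

/-- The surface has constant mean curvature `H`: half the trace of the second fundamental form with
respect to the first one, computed in any orthonormal basis of any tangent plane, is `H`. -/
def IsCMC (H : ℝ) : Prop :=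
  ∀ (x : S) (e₁ e₂ : TangentSpace (𝓡 2) x),
    F.firstForm x e₁ e₁ = 1 → F.firstForm x e₂ e₂ = 1 → F.firstForm x e₁ e₂ = 0 →
      (F.secondForm x e₁ e₁ + F.secondForm x e₂ e₂) / 2 = H

/-- The angle function `ν = ⟨N, ξ⟩`. -/
def angle (x : S) : ℝ := ambForm κ (F.normal x) vertField

/-- The tangential part `T = ξ - ν N` of the vertical field, as a vector of the ambient space. -/
def vertTangent (x : S) : Amb := vertField - F.angle x • F.normal x

/-- The Abresch-Rosenberg shape operator of a surface of constant mean curvature `H`,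
`S_AR X = 2H A X - κ⟨X, T⟩T + (κ/2)|T|² X - 2H² X`, with values written as vectors of the ambient
space. -/
def arShape (H : ℝ) (x : S) (X : TangentSpace (𝓡 2) x) : Amb :=
  (2 * H) • F.shape x X
    - (κ * ambForm κ (ambDeriv F.imm x X) (F.vertTangent x)) • F.vertTangent x
    + (κ / 2 * ambForm κ (F.vertTangent x) (F.vertTangent x)) • ambDeriv F.imm x X
    - (2 * H ^ 2) • ambDeriv F.imm x X

end ImmersedSurface

/-! ### Curves on surfaces -/

/-- The velocity of a curve on `S`. -/
def velocity (γ : ℝ → S) (t : ℝ) : TangentSpace (𝓡 2) (γ t) :=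
  mfderiv 𝓘(ℝ, ℝ) (𝓡 2) γ t (1 : ℝ)

/-- `γ : (-ε, ε) → S` is a smooth regular curve. -/
def IsRegularCurve (ε : ℝ) (γ : ℝ → S) : Prop :=
  ContMDiffOn 𝓘(ℝ, ℝ) (𝓡 2) ∞ γ (Ioo (-ε) ε) ∧ ∀ t ∈ Ioo (-ε) ε, velocity γ t ≠ 0

namespace ImmersedSurface

variable {κ : ℝ} (F : ImmersedSurface S κ)

/-- The regular curve `γ` on a surface of constant mean curvature `H` is an Abresch-Rosenberg line
of curvature: `S_AR(γ') = l γ'` with a smooth function `l`. -/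
def IsARLine (H ε : ℝ) (γ : ℝ → S) : Prop :=
  ∃ l : ℝ → ℝ, ContDiffOn ℝ ∞ l (Ioo (-ε) ε) ∧ ∀ t ∈ Ioo (-ε) ε,
    F.arShape H (γ t) (velocity γ t) = l t • ambDeriv F.imm (γ t) (velocity γ t)

/-- The curve is contained in a slice `M²(κ) × {h}`. -/
def IsHorizontal (ε : ℝ) (γ : ℝ → S) : Prop :=
  ∃ h : ℝ, ∀ t ∈ Ioo (-ε) ε, (F.imm (γ t)).2 = h

/-- The curve is, up to its parametrization, an integral curve of the tangential part `T` of the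
vertical field. -/
def IsVertical (ε : ℝ) (γ : ℝ → S) : Prop :=
  ∀ t ∈ Ioo (-ε) ε, ∃ c : ℝ, c ≠ 0 ∧
    ambDeriv F.imm (γ t) (velocity γ t) = c • F.vertTangent (γ t)

end ImmersedSurface

end Surfaces

end

/-!
Joachimsthal's argument. Write `V` for the common velocity of the two lifts of `Γ`, and
`a = ⟨A₁ V, N₂⟩`. As `⟨N₁, N₂⟩ = d` is constant, differentiation gives `⟨A₂ V, N₁⟩ = -a`.

Each tangent plane of a surface is the orthogonal complement of its normal, and by transversality
the two tangent planes meet in the line `ℝ V`. Since `S_AR V` is tangent to its own surface, `Γ` is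
an AR-line of one surface as soon as `S_AR V` is orthogonal to the normal of the other one
(`exists_smul_eq_of_orthogonal`). By `ImmersedSurface.ambForm_arShape` these conditions read
`2 H₁ a = κ ⟨V, ξ⟩ (ν₂ - d ν₁)` for the first surface and `-2 H₂ a = κ ⟨V, ξ⟩ (ν₁ - d ν₂)` for the
second. For a horizontal curve `⟨V, ξ⟩ = 0`, for a curve vertical in both surfaces both brackets
vanish, and the assumption that `H₁ = 0` forces `H₂ = 0` carries the first equation to the second;
for `H₁ = H₂` and `ν₁ = -ν₂` the two equations coincide.

The factor `l` in `S_AR V = l V` is smooth because it is a quotient `q(S_AR V, V) / q(V, V)` for a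
Euclidean scalar product `q` on `ℝ³ × ℝ` (`contDiffOn_of_smul_eq`).
-/

/-! ### The scalar products -/

theorem ambForm_comm (κ : ℝ) (v w : Amb) : ambForm κ v w = ambForm κ w v := by
  simp only [ambForm, baseForm]
  split_ifs <;> ring

theorem ambForm_add_left (κ : ℝ) (u v w : Amb) :
    ambForm κ (u + v) w = ambForm κ u w + ambForm κ v w := by
  simp only [ambForm, baseForm, Prod.fst_add, Prod.snd_add, Pi.add_apply]
  split_ifs <;> ring

theorem ambForm_smul_left (κ c : ℝ) (v w : Amb) :
    ambForm κ (c • v) w = c * ambForm κ v w := by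
  simp only [ambForm, baseForm, Prod.smul_fst, Prod.smul_snd, Pi.smul_apply, smul_eq_mul]
  split_ifs <;> ring

theorem ambForm_neg_left (κ : ℝ) (v w : Amb) : ambForm κ (-v) w = -ambForm κ v w := by
  simpa using ambForm_smul_left κ (-1) v w

theorem ambForm_sub_left (κ : ℝ) (u v w : Amb) :
    ambForm κ (u - v) w = ambForm κ u w - ambForm κ v w := by
  rw [sub_eq_add_neg, ambForm_add_left, ambForm_neg_left, sub_eq_add_neg]

theorem ambForm_add_right (κ : ℝ) (u v w : Amb) :
    ambForm κ u (v + w) = ambForm κ u v + ambForm κ u w := by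
  rw [ambForm_comm, ambForm_add_left, ambForm_comm κ v, ambForm_comm κ w]

theorem ambForm_smul_right (κ c : ℝ) (v w : Amb) :
    ambForm κ v (c • w) = c * ambForm κ v w := by
  rw [ambForm_comm, ambForm_smul_left, ambForm_comm κ w]

theorem ambForm_sub_right (κ : ℝ) (u v w : Amb) :
    ambForm κ u (v - w) = ambForm κ u v - ambForm κ u w := by
  rw [ambForm_comm, ambForm_sub_left, ambForm_comm κ v, ambForm_comm κ w]

theorem ambForm_vertField (κ : ℝ) (v : Amb) : ambForm κ v vertField = v.2 := by
  simp [ambForm, baseForm, vertField]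

theorem ambForm_tangProj {κ : ℝ} {p n : Amb} (hn : n ∈ tangentPlane κ p) (v : Amb) :
    ambForm κ (tangProj κ p v) n = ambForm κ v n := by
  have h : baseForm κ p.1 n.1 = 0 := hn
  have e : ambForm κ (tangProj κ p v) n
      = ambForm κ v n - κ * baseForm κ v.1 p.1 * baseForm κ p.1 n.1 := by
    simp only [ambForm, tangProj, baseForm, Pi.sub_apply, Pi.smul_apply, smul_eq_mul]
    split_ifs <;> ring
  rw [e, h, mul_zero, sub_zero]

/-- The scalar product of `ℝ³ × ℝ` with a fixed vector. -/
noncomputable def ambFunctional (κ : ℝ) (n : Amb) : Amb →ₗ[ℝ] ℝ where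
  toFun := ambForm κ n
  map_add' := ambForm_add_right κ n
  map_smul' c := ambForm_smul_right κ c n

theorem vertField_mem_tangentPlane (κ : ℝ) (p : Amb) : vertField ∈ tangentPlane κ p := by
  change baseForm κ p.1 vertField.1 = 0
  simp [baseForm, vertField]

theorem tangentPlane_eq_ker (κ : ℝ) (p : Amb) :
    tangentPlane κ p = (ambFunctional κ (p.1, 0)).ker := by
  ext v
  change baseForm κ p.1 v.1 = 0 ↔ baseForm κ p.1 v.1 + 0 * v.2 = 0
  simp

theorem finrank_tangentPlane {κ : ℝ} (hκ : κ ≠ 0) {p : Amb} (hp : p ∈ prodSpace κ) :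
    Module.finrank ℝ (tangentPlane κ p) = 3 := by
  have hne : ambFunctional κ (p.1, 0) ≠ 0 := by
    intro h
    have h1 : baseForm κ p.1 p.1 + 0 * 0 = 0 := LinearMap.congr_fun h (p.1, 0)
    have h2 : baseForm κ p.1 p.1 = 1 / κ := hp.1
    rw [h2, mul_zero, add_zero] at h1
    exact one_div_ne_zero hκ h1
  have h := Module.Dual.finrank_ker_add_one_of_ne_zero hne
  rw [tangentPlane_eq_ker]
  have h4 : Module.finrank ℝ Amb = 4 := by simp [Amb]
  omega

/-- A plane in the tangent space of the ambient product is the full orthogonal complement of any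
of its unit normals. -/
theorem mem_of_ambForm_eq_zero {κ : ℝ} (hκ : κ ≠ 0) {p n : Amb} (hp : p ∈ prodSpace κ)
    (hn : n ∈ tangentPlane κ p) (hn1 : ambForm κ n n = 1) {R : Submodule ℝ Amb}
    (hR : R ≤ tangentPlane κ p) (hR2 : Module.finrank ℝ R = 2)
    (hRn : ∀ v ∈ R, ambForm κ n v = 0) {u : Amb} (hu : u ∈ tangentPlane κ p)
    (hun : ambForm κ n u = 0) : u ∈ R := by
  have hle : R ≤ tangentPlane κ p ⊓ (ambFunctional κ n).ker :=
    le_inf hR fun v hv => hRn v hv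
  have hlt : tangentPlane κ p ⊓ (ambFunctional κ n).ker < tangentPlane κ p := by
    refine lt_of_le_of_ne inf_le_left fun h => ?_
    have h0 : ambForm κ n n = 0 := (h.ge hn).2
    rw [hn1] at h0
    exact one_ne_zero h0
  have h1 := Submodule.finrank_lt_finrank_of_lt hlt
  rw [finrank_tangentPlane hκ hp] at h1
  have : R = tangentPlane κ p ⊓ (ambFunctional κ n).ker :=
    Submodule.eq_of_le_of_finrank_le hle (by omega)
  rw [this]
  exact ⟨hu, hun⟩

/-- Two planes that span a three-dimensional space meet in a line. -/
theorem exists_smul_eq_of_mem_inf {P R₁ R₂ : Submodule ℝ Amb} (hP : Module.finrank ℝ P = 3)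
    (h₁ : Module.finrank ℝ R₁ = 2) (h₂ : Module.finrank ℝ R₂ = 2) (hsup : R₁ ⊔ R₂ = P)
    {V u : Amb} (hV : V ∈ R₁ ⊓ R₂) (hV0 : V ≠ 0) (hu : u ∈ R₁ ⊓ R₂) : ∃ c : ℝ, c • V = u := by
  have h := Submodule.finrank_sup_add_finrank_inf_eq R₁ R₂
  rw [hsup, hP, h₁, h₂] at h
  have h1 : Module.finrank ℝ ↥(R₁ ⊓ R₂) = 1 := by omega
  obtain ⟨c, hc⟩ := exists_smul_eq_of_finrank_eq_one h1
    (x := (⟨V, hV⟩ : ↥(R₁ ⊓ R₂))) (by simpa [Subtype.ext_iff] using hV0) ⟨u, hu⟩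
  exact ⟨c, congrArg Subtype.val hc⟩

/-- Two transversal planes of the ambient tangent space, with unit normals `n₁` and `n₂`, meet in
the line spanned by any common nonzero vector `V`; that line is the orthogonal complement of `n₁`
and `n₂`. -/
theorem exists_smul_eq_of_orthogonal {κ : ℝ} (hκ : κ ≠ 0) {p n₁ n₂ : Amb}
    (hp : p ∈ prodSpace κ) (hn₁ : n₁ ∈ tangentPlane κ p) (hn₁1 : ambForm κ n₁ n₁ = 1)
    (hn₂ : n₂ ∈ tangentPlane κ p) (hn₂1 : ambForm κ n₂ n₂ = 1) {R₁ R₂ : Submodule ℝ Amb}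
    (h₁ : Module.finrank ℝ R₁ = 2) (h₂ : Module.finrank ℝ R₂ = 2)
    (hsup : R₁ ⊔ R₂ = tangentPlane κ p)
    (hRn₁ : ∀ v ∈ R₁, ambForm κ n₁ v = 0) (hRn₂ : ∀ v ∈ R₂, ambForm κ n₂ v = 0)
    {V u : Amb} (hV₁ : V ∈ R₁) (hV₂ : V ∈ R₂) (hV0 : V ≠ 0) (hu : u ∈ tangentPlane κ p)
    (hu₁ : ambForm κ n₁ u = 0) (hu₂ : ambForm κ n₂ u = 0) : ∃ c : ℝ, c • V = u :=
  exists_smul_eq_of_mem_inf (finrank_tangentPlane hκ hp) h₁ h₂ hsup ⟨hV₁, hV₂⟩ hV0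
    ⟨mem_of_ambForm_eq_zero hκ hp hn₁ hn₁1 (hsup ▸ le_sup_left) h₁ hRn₁ hu hu₁,
      mem_of_ambForm_eq_zero hκ hp hn₂ hn₂1 (hsup ▸ le_sup_right) h₂ hRn₂ hu hu₂⟩

/-! ### Smoothness and derivatives along a curve -/

theorem ContDiffOn.baseForm {κ : ℝ} {s : Set ℝ} {f g : ℝ → Fin 3 → ℝ}
    (hf : ContDiffOn ℝ ∞ f s) (hg : ContDiffOn ℝ ∞ g s) :
    ContDiffOn ℝ ∞ (fun t => baseForm κ (f t) (g t)) s := by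
  rw [contDiffOn_pi] at hf hg
  have h i := (hf i).mul (hg i)
  unfold _root_.baseForm
  split_ifs
  · exact ((h 0).add (h 1)).add (h 2)
  · exact ((h 0).neg.add (h 1)).add (h 2)

theorem ContDiffOn.ambForm {κ : ℝ} {s : Set ℝ} {f g : ℝ → Amb}
    (hf : ContDiffOn ℝ ∞ f s) (hg : ContDiffOn ℝ ∞ g s) :
    ContDiffOn ℝ ∞ (fun t => ambForm κ (f t) (g t)) s :=
  (hf.fst.baseForm hg.fst).add (hf.snd.mul hg.snd)

theorem ContDiffOn.tangProj {κ : ℝ} {s : Set ℝ} {f g : ℝ → Amb}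
    (hf : ContDiffOn ℝ ∞ f s) (hg : ContDiffOn ℝ ∞ g s) :
    ContDiffOn ℝ ∞ (fun t => tangProj κ (f t) (g t)) s :=
  (hg.fst.sub ((contDiffOn_const.mul (hg.fst.baseForm hf.fst)).smul hf.fst)).prodMk hg.snd

theorem HasDerivAt.ambSnd {f : ℝ → Amb} {f' : Amb} {t : ℝ} (hf : HasDerivAt f f' t) :
    HasDerivAt (fun s => (f s).2) f'.2 t :=
  (hasFDerivAt_snd (𝕜 := ℝ) (p := f t)).comp_hasDerivAt t hf

theorem HasDerivAt.ambFst {f : ℝ → Amb} {f' : Amb} {t : ℝ} (hf : HasDerivAt f f' t)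
    (i : Fin 3) : HasDerivAt (fun s => (f s).1 i) (f'.1 i) t :=
  have h : HasDerivAt (fun s => (f s).1) f'.1 t :=
    (hasFDerivAt_fst (𝕜 := ℝ) (p := f t)).comp_hasDerivAt t hf
  hasDerivAt_pi.1 h i

theorem HasDerivAt.ambForm {κ : ℝ} {f g : ℝ → Amb} {f' g' : Amb} {t : ℝ}
    (hf : HasDerivAt f f' t) (hg : HasDerivAt g g' t) :
    HasDerivAt (fun s => ambForm κ (f s) (g s)) (ambForm κ f' (g t) + ambForm κ (f t) g') t := by
  have h i := (hf.ambFst i).mul (hg.ambFst i)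
  have h' := hf.ambSnd.mul hg.ambSnd
  unfold _root_.ambForm _root_.baseForm
  split_ifs
  · exact ((((h 0).add (h 1)).add (h 2)).add h').congr_deriv (by ring)
  · exact ((((h 0).neg.add (h 1)).add (h 2)).add h').congr_deriv (by ring)

/-- The quotient of two proportional smooth curves of `ℝ³ × ℝ` is smooth where the denominator
does not vanish. -/
theorem contDiffOn_of_smul_eq {s : Set ℝ} {V u : ℝ → Amb} {l : ℝ → ℝ}
    (hV : ContDiffOn ℝ ∞ V s) (hu : ContDiffOn ℝ ∞ u s) (hV0 : ∀ t ∈ s, V t ≠ 0)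
    (hl : ∀ t ∈ s, l t • V t = u t) : ContDiffOn ℝ ∞ l s := by
  -- For positive parameter `ambForm` is the Euclidean scalar product.
  have hpos : ∀ v : Amb, v ≠ 0 → ambForm 1 v v ≠ 0 := by
    intro v hv h
    have e : v.1 0 * v.1 0 + v.1 1 * v.1 1 + v.1 2 * v.1 2 + v.2 * v.2 = 0 := by
      simpa [ambForm, baseForm] using h
    have h0 : v.1 0 = 0 := by nlinarith [sq_nonneg (v.1 1), sq_nonneg (v.1 2), sq_nonneg v.2]
    have h1 : v.1 1 = 0 := by nlinarith [sq_nonneg (v.1 0), sq_nonneg (v.1 2), sq_nonneg v.2]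
    have h2 : v.1 2 = 0 := by nlinarith [sq_nonneg (v.1 0), sq_nonneg (v.1 1), sq_nonneg v.2]
    have h3 : v.2 = 0 := by nlinarith [sq_nonneg (v.1 0), sq_nonneg (v.1 1), sq_nonneg (v.1 2)]
    refine hv (Prod.ext (funext fun i => ?_) h3)
    fin_cases i
    exacts [h0, h1, h2]
  refine ((hu.ambForm (κ := 1) hV).div (hV.ambForm (κ := 1) hV)
    fun t ht => hpos _ (hV0 t ht)).congr fun t ht => ?_
  simp only [Pi.div_apply]
  rw [← hl t ht, ambForm_smul_left, mul_div_cancel_right₀ _ (hpos _ (hV0 t ht))]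

section Curves

variable {S : Type*} [TopologicalSpace S] [ChartedSpace (EuclideanSpace ℝ (Fin 2)) S]
  {ε : ℝ} {γ : ℝ → S}

theorem IsRegularCurve.contDiffOn_comp (hγ : IsRegularCurve ε γ) {g : S → Amb}
    (hg : ContMDiff (𝓡 2) 𝓘(ℝ, Amb) ∞ g) : ContDiffOn ℝ ∞ (g ∘ γ) (Ioo (-ε) ε) :=
  contMDiffOn_iff_contDiffOn.1 (hg.comp_contMDiffOn hγ.1)

theorem IsRegularCurve.hasDerivAt_comp (hγ : IsRegularCurve ε γ) {g : S → Amb}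
    (hg : ContMDiff (𝓡 2) 𝓘(ℝ, Amb) ∞ g) {t : ℝ} (ht : t ∈ Ioo (-ε) ε) :
    HasDerivAt (g ∘ γ) (ambDeriv g (γ t) (velocity γ t)) t := by
  have h1 : MDifferentiableAt 𝓘(ℝ, ℝ) (𝓡 2) γ t :=
    (hγ.1.contMDiffAt (isOpen_Ioo.mem_nhds ht)).mdifferentiableAt (by simp)
  have h2 : MDifferentiableAt (𝓡 2) 𝓘(ℝ, Amb) g (γ t) :=
    hg.mdifferentiableAt (by simp)
  have h3 : HasFDerivAt (𝕜 := ℝ) (g ∘ γ)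
      ((ambDeriv g (γ t)).comp (mfderiv 𝓘(ℝ, ℝ) (𝓡 2) γ t) : ℝ →L[ℝ] Amb) t :=
    (h2.hasMFDerivAt.comp t h1.hasMFDerivAt).hasFDerivAt
  exact h3.hasDerivAt

theorem IsRegularCurve.contDiffOn_ambDeriv (hγ : IsRegularCurve ε γ) {g : S → Amb}
    (hg : ContMDiff (𝓡 2) 𝓘(ℝ, Amb) ∞ g) :
    ContDiffOn ℝ ∞ (fun t => (ambDeriv g (γ t) (velocity γ t) : Amb)) (Ioo (-ε) ε) :=
  ((hγ.contDiffOn_comp hg).deriv_of_isOpen (m := ∞) isOpen_Ioo (by simp)).congr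
    fun _ ht => (hγ.hasDerivAt_comp hg ht).deriv.symm

/-! ### The Abresch–Rosenberg shape operator along a curve -/

namespace ImmersedSurface

variable {κ : ℝ} (F : ImmersedSurface S κ)

theorem ambForm_vertTangent (x : S) (w : Amb) :
    ambForm κ (F.vertTangent x) w = w.2 - F.angle x * ambForm κ (F.normal x) w := by
  rw [vertTangent, ambForm_sub_left, ambForm_smul_left, ambForm_comm κ vertField,
    ambForm_vertField]

theorem angle_eq (x : S) : F.angle x = (F.normal x).2 := ambForm_vertField κ _

theorem ambForm_normal_vertTangent (x : S) :
    ambForm κ (F.normal x) (F.vertTangent x) = 0 := by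
  rw [ambForm_comm, ambForm_vertTangent, F.normal_unit, angle_eq, mul_one, sub_self]

theorem ambForm_ambDeriv_vertTangent (x : S) (X : TangentSpace (𝓡 2) x) :
    ambForm κ (ambDeriv F.imm x X) (F.vertTangent x) = Prod.snd (ambDeriv F.imm x X) := by
  rw [ambForm_comm, ambForm_vertTangent, F.normal_orthogonal, mul_zero, sub_zero]

theorem vertTangent_mem (x : S) : F.vertTangent x ∈ tangentPlane κ (F.imm x) :=
  Submodule.sub_mem _ (vertField_mem_tangentPlane κ _)
    (Submodule.smul_mem _ _ (F.normal_mem x))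

theorem ambForm_shape {x : S} (X : TangentSpace (𝓡 2) x) {n : Amb}
    (hn : n ∈ tangentPlane κ (F.imm x)) :
    ambForm κ (F.shape x X) n = -ambForm κ (ambDeriv F.normal x X) n := by
  rw [shape, ambForm_neg_left, ambForm_tangProj hn]

theorem arShape_mem (hκ : κ ≠ 0) (H : ℝ) {x : S} {X : TangentSpace (𝓡 2) x}
    (hX : ambDeriv F.imm x X ∈ tangentPlane κ (F.imm x)) :
    F.arShape H x X ∈ tangentPlane κ (F.imm x) := by
  refine Submodule.sub_mem _ (Submodule.add_mem _ (Submodule.sub_mem _ ?_ ?_) ?_) ?_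
  · exact Submodule.smul_mem _ _ (Submodule.neg_mem _ (tangProj_mem hκ (F.imm_mem x) _))
  · exact Submodule.smul_mem _ _ (F.vertTangent_mem x)
  · exact Submodule.smul_mem _ _ hX
  · exact Submodule.smul_mem _ _ hX

/-- The terms of `S_AR X` that are multiples of `X` do not contribute to its product with a vector
orthogonal to `X`. -/
theorem ambForm_arShape (H : ℝ) {x : S} {X : TangentSpace (𝓡 2) x} {n : Amb}
    (hn : n ∈ tangentPlane κ (F.imm x)) (hnX : ambForm κ n (ambDeriv F.imm x X) = 0) :
    ambForm κ n (F.arShape H x X) = -(2 * H * ambForm κ (ambDeriv F.normal x X) n)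
      - κ * Prod.snd (ambDeriv F.imm x X) * ambForm κ n (F.vertTangent x) := by
  rw [arShape, ambForm_sub_right, ambForm_add_right, ambForm_sub_right, ambForm_smul_right,
    ambForm_smul_right, ambForm_smul_right, ambForm_smul_right, ambForm_comm κ n (F.shape x X),
    F.ambForm_shape X hn, hnX, F.ambForm_ambDeriv_vertTangent]
  ring

theorem finrank_range_ambDeriv (x : S) :
    Module.finrank ℝ (ambDeriv F.imm x).range = 2 := by
  have h := LinearMap.finrank_range_of_inj (f := (ambDeriv F.imm x).toLinearMap)
    (F.imm_injective x)
  refine h.trans ?_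
  change Module.finrank ℝ (EuclideanSpace ℝ (Fin 2)) = 2
  simp

theorem ambDeriv_velocity_ne_zero (hγ : IsRegularCurve ε γ) {t : ℝ} (ht : t ∈ Ioo (-ε) ε) :
    ambDeriv F.imm (γ t) (velocity γ t) ≠ 0 := fun h =>
  hγ.2 t ht (F.imm_injective (γ t) (h.trans (map_zero _).symm))

/-- The shape operator takes values in the tangent plane of the surface, as the normal has constant
length. -/
theorem ambForm_ambDeriv_normal (hγ : IsRegularCurve ε γ) {t : ℝ} (ht : t ∈ Ioo (-ε) ε) :
    ambForm κ (ambDeriv F.normal (γ t) (velocity γ t)) (F.normal (γ t)) = 0 := by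
  have h := hγ.hasDerivAt_comp F.normal_smooth ht
  have h1 := h.ambForm (κ := κ) h
  have h2 : (fun s => ambForm κ ((F.normal ∘ γ) s) ((F.normal ∘ γ) s)) = fun _ => (1 : ℝ) :=
    funext fun s => F.normal_unit (γ s)
  rw [h2] at h1
  have h3 := h1.unique (hasDerivAt_const t 1)
  rw [ambForm_comm κ ((F.normal ∘ γ) t)] at h3
  simp only [Function.comp_apply] at h3
  linarith

theorem contDiffOn_arShape (hγ : IsRegularCurve ε γ) (H : ℝ) :
    ContDiffOn ℝ ∞ (fun t => F.arShape H (γ t) (velocity γ t)) (Ioo (-ε) ε) := by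
  have hc := hγ.contDiffOn_comp F.imm_smooth
  have hn := hγ.contDiffOn_comp F.normal_smooth
  have hV := hγ.contDiffOn_ambDeriv F.imm_smooth
  have hW := hγ.contDiffOn_ambDeriv F.normal_smooth
  have hT : ContDiffOn ℝ ∞ (fun t => F.vertTangent (γ t)) (Ioo (-ε) ε) :=
    contDiffOn_const.sub ((hn.ambForm contDiffOn_const).smul hn)
  have hA : ContDiffOn ℝ ∞ (fun t => F.shape (γ t) (velocity γ t)) (Ioo (-ε) ε) :=
    (hc.tangProj hW).neg
  have h1 := hA.const_smul (2 * H)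
  have h2 := ((hV.ambForm (κ := κ) hT).const_smul κ).smul hT
  have h3 := ((hT.ambForm (κ := κ) hT).const_smul (κ / 2)).smul hV
  have h4 := hV.const_smul (2 * H ^ 2)
  exact ((h1.sub h2).add h3).sub h4

end ImmersedSurface

end Curves

/-! ### The transfer of AR-lines of curvature -/

theorem mainTheorem6 (κ : ℝ) (hκ : κ ≠ 0)
    {S₁ : Type*} [TopologicalSpace S₁] [ChartedSpace (EuclideanSpace ℝ (Fin 2)) S₁]
    [IsManifold (𝓡 2) ∞ S₁]
    {S₂ : Type*} [TopologicalSpace S₂] [ChartedSpace (EuclideanSpace ℝ (Fin 2)) S₂]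
    [IsManifold (𝓡 2) ∞ S₂]
    (F₁ : ImmersedSurface S₁ κ) (F₂ : ImmersedSurface S₂ κ)
    (H₁ H₂ : ℝ) (hH₁ : F₁.IsCMC H₁) (hH₂ : F₂.IsCMC H₂)
    (hmin : H₁ = 0 → H₂ = 0)
    (ε : ℝ) (hε : 0 < ε) (γ₁ : ℝ → S₁) (γ₂ : ℝ → S₂)
    (hγ₁ : IsRegularCurve ε γ₁) (hγ₂ : IsRegularCurve ε γ₂)
    (hγ : ∀ t ∈ Ioo (-ε) ε, F₁.imm (γ₁ t) = F₂.imm (γ₂ t))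
    (htransversal : ∀ t ∈ Ioo (-ε) ε,
      (ambDeriv F₁.imm (γ₁ t)).range ⊔ (ambDeriv F₂.imm (γ₂ t)).range
        = tangentPlane κ (F₁.imm (γ₁ t)))
    (hangle : ∃ d : ℝ, ∀ t ∈ Ioo (-ε) ε,
      ambForm κ (F₁.normal (γ₁ t)) (F₂.normal (γ₂ t)) = d)
    (hAR : F₁.IsARLine H₁ ε γ₁)
    (hcase : F₁.IsHorizontal ε γ₁ ∨
      (F₁.IsVertical ε γ₁ ∧ F₂.IsVertical ε γ₂) ∨
      (H₁ = H₂ ∧ H₁ ≠ 0 ∧ ∀ t ∈ Ioo (-ε) ε, F₁.angle (γ₁ t) = -F₂.angle (γ₂ t))) :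
    F₂.IsARLine H₂ ε γ₂ := by
  obtain ⟨d, hd⟩ := hangle
  obtain ⟨l₁, -, hl₁⟩ := hAR
  have key : ∀ t ∈ Ioo (-ε) ε, ∃ c : ℝ,
      c • (ambDeriv F₂.imm (γ₂ t) (velocity γ₂ t) : Amb)
        = F₂.arShape H₂ (γ₂ t) (velocity γ₂ t) := by
    intro t ht
    have hnhds : Ioo (-ε) ε ∈ nhds t := isOpen_Ioo.mem_nhds ht
    have hp := hγ t ht
    have hn₁ := F₁.normal_mem (γ₁ t)
    have hn₂ : F₂.normal (γ₂ t) ∈ tangentPlane κ (F₁.imm (γ₁ t)) := hp ▸ F₂.normal_mem (γ₂ t)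
    have hV : (ambDeriv F₁.imm (γ₁ t) (velocity γ₁ t) : Amb)
        = ambDeriv F₂.imm (γ₂ t) (velocity γ₂ t) := by
      refine (hγ₁.hasDerivAt_comp F₁.imm_smooth ht).unique
        ((hγ₂.hasDerivAt_comp F₂.imm_smooth ht).congr_of_eventuallyEq ?_)
      filter_upwards [hnhds] with s hs using hγ s hs
    have hV₁N₂ : ambForm κ (F₂.normal (γ₂ t)) (ambDeriv F₁.imm (γ₁ t) (velocity γ₁ t)) = 0 := by
      rw [hV]; exact F₂.normal_orthogonal _ _
    have hV₂N₁ : ambForm κ (F₁.normal (γ₁ t)) (ambDeriv F₂.imm (γ₂ t) (velocity γ₂ t)) = 0 := by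
      rw [← hV]; exact F₁.normal_orthogonal _ _
    have hVmem : ambDeriv F₂.imm (γ₂ t) (velocity γ₂ t) ∈ tangentPlane κ (F₂.imm (γ₂ t)) := by
      rw [← hp, ← htransversal t ht]
      exact Submodule.mem_sup_right (LinearMap.mem_range_self _ _)
    -- Joachimsthal: the derivative of the constant `⟨N₁, N₂⟩` vanishes.
    have hJ : ambForm κ (ambDeriv F₁.normal (γ₁ t) (velocity γ₁ t)) (F₂.normal (γ₂ t))
        + ambForm κ (F₁.normal (γ₁ t)) (ambDeriv F₂.normal (γ₂ t) (velocity γ₂ t)) = 0 := by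
      refine ((hγ₁.hasDerivAt_comp F₁.normal_smooth ht).ambForm
        (hγ₂.hasDerivAt_comp F₂.normal_smooth ht)).unique
        ((hasDerivAt_const t d).congr_of_eventuallyEq ?_)
      filter_upwards [hnhds] with s hs using hd s hs
    have hAR₁ : ambForm κ (F₂.normal (γ₂ t)) (F₁.arShape H₁ (γ₁ t) (velocity γ₁ t)) = 0 := by
      rw [hl₁ t ht, ambForm_smul_right, hV₁N₂, mul_zero]
    rw [F₁.ambForm_arShape H₁ hn₂ hV₁N₂, hV] at hAR₁
    have hgoal : ambForm κ (F₁.normal (γ₁ t)) (F₂.arShape H₂ (γ₂ t) (velocity γ₂ t)) = 0 := by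
      rw [F₂.ambForm_arShape H₂ (hp ▸ hn₁) hV₂N₁, ambForm_comm κ _ (F₁.normal (γ₁ t)),
        eq_neg_of_add_eq_zero_right hJ]
      -- Used where both `κ`-terms vanish: `H₁ a = 0` gives `H₂ a = 0`, as `H₁ = 0` forces `H₂ = 0`.
      have hvanish (h : H₁ * ambForm κ (ambDeriv F₁.normal (γ₁ t) (velocity γ₁ t))
          (F₂.normal (γ₂ t)) = 0) : H₂ * ambForm κ (ambDeriv F₁.normal (γ₁ t) (velocity γ₁ t))
          (F₂.normal (γ₂ t)) = 0 := by
        rcases mul_eq_zero.1 h with h | h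
        · rw [hmin h, zero_mul]
        · rw [h, mul_zero]
      rcases hcase with ⟨h, hh⟩ | ⟨hv₁, hv₂⟩ | ⟨hH, -, hν⟩
      · have hV0 : Prod.snd (ambDeriv F₂.imm (γ₂ t) (velocity γ₂ t)) = 0 := by
          rw [← hV]
          refine (hγ₁.hasDerivAt_comp F₁.imm_smooth ht).ambSnd.unique
            ((hasDerivAt_const t h).congr_of_eventuallyEq ?_)
          filter_upwards [hnhds] with s hs using hh s hs
        rw [hV0] at hAR₁ ⊢
        linear_combination 2 * hvanish (by linear_combination -hAR₁ / 2)
      · obtain ⟨c₁, hc₁, hv₁⟩ := hv₁ t ht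
        obtain ⟨c₂, hc₂, hv₂⟩ := hv₂ t ht
        rw [hv₁, ambForm_smul_right] at hV₁N₂
        rw [hv₂, ambForm_smul_right] at hV₂N₁
        rw [(mul_eq_zero.1 hV₁N₂).resolve_left hc₁] at hAR₁
        rw [(mul_eq_zero.1 hV₂N₁).resolve_left hc₂]
        linear_combination 2 * hvanish (by linear_combination -hAR₁ / 2)
      · have hν := hν t ht
        rw [ambForm_comm κ _ (F₁.vertTangent _), F₁.ambForm_vertTangent, hd t ht, ← F₂.angle_eq, hν] at hAR₁
        rw [ambForm_comm κ _ (F₂.vertTangent _), F₂.ambForm_vertTangent, ambForm_comm κ _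
          (F₁.normal _), hd t ht, ← F₁.angle_eq, hν, ← hH]
        linear_combination -hAR₁
    have hself : ambForm κ (F₂.normal (γ₂ t)) (F₂.arShape H₂ (γ₂ t) (velocity γ₂ t)) = 0 := by
      rw [F₂.ambForm_arShape H₂ (F₂.normal_mem _) (F₂.normal_orthogonal _ _),
        F₂.ambForm_ambDeriv_normal hγ₂ ht, F₂.ambForm_normal_vertTangent]
      ring
    refine exists_smul_eq_of_orthogonal hκ (F₁.imm_mem (γ₁ t)) hn₁ (F₁.normal_unit _) hn₂
      (F₂.normal_unit _) (F₁.finrank_range_ambDeriv _) (F₂.finrank_range_ambDeriv _)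
      (htransversal t ht) ?_ ?_ ?_ (LinearMap.mem_range_self _ _)
      (F₂.ambDeriv_velocity_ne_zero hγ₂ ht) ?_ hgoal hself
    · rintro _ ⟨X, rfl⟩
      exact F₁.normal_orthogonal _ X
    · rintro _ ⟨X, rfl⟩
      exact F₂.normal_orthogonal _ X
    · rw [← hV]
      exact LinearMap.mem_range_self _ _
    · rw [hp]
      exact F₂.arShape_mem hκ H₂ hVmem
  choose! l hl using key
  exact ⟨l, contDiffOn_of_smul_eq (hγ₂.contDiffOn_ambDeriv F₂.imm_smooth)
    (F₂.contDiffOn_arShape hγ₂ H₂) (fun t ht => F₂.ambDeriv_velocity_ne_zero hγ₂ ht) hl,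
    fun t ht => (hl t ht).symm⟩
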